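/- Let $K \ge 2$ be the number of arms and let $\Theta = (\theta_1, \dots, \theta_N)$ be a known family of $N = K$ policies (probability distributions over $[K]$) that is $\epsilon$-uniform for some $0 \le \epsilon \le 1$: each policy $\theta$ is associated one-to-one with an arm $a_\theta$, and $\theta(j) = \frac{1-\epsilon}{K} + \epsilon\,\mathbb{I}\{j = a_\theta\}$ for every arm $j$. For a sequence of loss vectors $\ell_1, \dots, \ell_T \in [0,1]^K$ unknown to the player, in each round $t = 1, \dots, T$ the player selects, possibly at random and depending on all past observations, a policy $\theta_t \in \Theta$; an action $A_t \in [K]$ is then drawn from $\theta_t$; and the player observes $(A_t, \ell_t(A_t))$. Write $\ell_t(\theta) = \sum_{j=1}^K \theta(j)\,\ell_t(j)$, and define the regret $$R_T = \mathbb{E}\sum_{t=1}^T \ell_t(\theta_t) - \min_{\theta \in \Theta} \sum_{t=1}^T \ell_t(\theta),$$ where the expectation is over the player's randomization and the draws of the actions. Then, for every integer $T \ge \frac{K}{4\log(4/3)}$ (natural logarithm) and every algorithm of the player, which may depend on $K$, $\Theta$ and $T$, there exists a sequence of losses $\ell_1, \dots, \ell_T \in [0,1]^K$ such that $$R_T \ge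 \frac{1}{18}\,\epsilon\,\sqrt{KT}.$$ -/

import Mathlib

namespace FixedAdvice

/-- What the player observes in one round: the policy it selected, the action drawn from that
policy, and the loss of that action. -/
abbrev Observation (N K : ℕ) : Type := Fin N × Fin K × ℝ

/-- A (randomized) algorithm for `N` policies over `K` arms: for every round `t` and every list of
observations from the `t` previous rounds, a distribution over the policies. The dependence on the
past is arbitrary. -/
def Strategy (N K : ℕ) : Type := (t : ℕ) → (Fin t → Observation N K) → PMF (Fin N)

/-- The policies selected and the actions drawn in the first `t` rounds. -/
abbrev Play (N K t : ℕ) : Type := Fin t → Fin N × Fin K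

variable {N K : ℕ}

/-- The observations produced by a play when the loss vectors are `ℓ 0, ℓ 1, …`. -/
def observations (ℓ : ℕ → Fin K → ℝ) {t : ℕ} (h : Play N K t) : Fin t → Observation N K :=
  fun s => ((h s).1, (h s).2, ℓ s (h s).2)

/-- The law of the first `t` rounds when the algorithm `π` faces the loss vectors `ℓ 0, ℓ 1, …`:
in each round a policy `i` is drawn from the distribution given by `π` and the past observations,
then an action is drawn from `Θ i`. -/
noncomputable def playLaw (Θ : Fin N → PMF (Fin K)) (π : Strategy N K) (ℓ : ℕ → Fin K → ℝ) :
    (t : ℕ) → PMF (Play N K t)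
  | 0 => PMF.pure Fin.elim0
  | t + 1 =>
    (playLaw Θ π ℓ t).bind fun h =>
      (π t (observations ℓ h)).bind fun i =>
        (Θ i).bind fun j =>
          PMF.pure (Fin.snoc (α := fun _ => Fin N × Fin K) h (i, j))

/-- The expected loss `∑ j, θ(j) v(j)` of the policy `θ` under the loss vector `v`. -/
noncomputable def policyLoss (θ : PMF (Fin K)) (v : Fin K → ℝ) : ℝ :=
  ∑ j, (θ j).toReal * v j

/-- The expectation, over the randomness of the interaction in `T` rounds, of the sum of the
losses of the selected policies. -/
noncomputable def expectedLoss (Θ : Fin N → PMF (Fin K)) (π : Strategy N K) (ℓ : ℕ → Fin K → ℝ)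
    (T : ℕ) : ℝ :=
  ∑ h : Play N K T, (playLaw Θ π ℓ T h).toReal * ∑ t : Fin T, policyLoss (Θ (h t).1) (ℓ t)

/-- The regret after `T` rounds against the best policy in hindsight; the infimum is a minimum,
as there are finitely many policies. -/
noncomputable def regret (Θ : Fin N → PMF (Fin K)) (π : Strategy N K) (ℓ : ℕ → Fin K → ℝ)
    (T : ℕ) : ℝ :=
  expectedLoss Θ π ℓ T - ⨅ i : Fin N, ∑ t : Fin T, policyLoss (Θ i) (ℓ t)

/-- The `ε`-uniform structure: `N = K`, and the policies correspond one-to-one to the arms, the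
policy with arm `a` playing `j` with probability `(1 - ε) / K + ε 𝟙{j = a}`. -/
structure IsEpsUniform (ε : ℝ) (Θ : Fin N → PMF (Fin K)) : Prop where
  nonneg : 0 ≤ ε
  le_one : ε ≤ 1
  card_eq : N = K
  exists_arm : ∃ a : Fin N → Fin K, Function.Bijective a ∧
    ∀ i j, (Θ i j).toReal = (1 - ε) / K + ε * (if j = a i then 1 else 0)

end FixedAdvice

namespace FixedAdvice

/-! ### Law of a play -/

section Law

variable {N K : ℕ} (Θ : Fin N → PMF (Fin K)) (π : Strategy N K)

/-! Losses are random bits, fair except that one hidden arm `a i` has mean `1/2 - δ`. Each round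
with a policy other than `i` then costs `ε * δ` more than policy `i`, so the mean regret under law
`i` is at least `ε * δ * (T - n_i)`, with `n_i` the expected number of selections of `i`. It remains
to bound `∑ i, n_i`.

By `sum_mul_le_of_density`, `n_i / T` exceeds its value under fair bits by at most a relative
entropy plus `13/100`. Under fair bits the counts sum to `T`. The entropies sum to a quantity of
order `T * δ ^ 2` for every strategy, since each round reveals one bit of one arm
(`sum_meanCount_biasedWeight_le`). This information does not depend on `ε`, so `δ` of order `√(K /
T)` gives regret of order `ε * √(K * T)`. Some fixed table does at least as badly as the average
over the arms and tables. -/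

theorem playLaw_succ_snoc (ℓ : ℕ → Fin K → ℝ) (t : ℕ) (h : Play N K t) (i : Fin N) (j : Fin K) :
    playLaw Θ π ℓ (t + 1) (Fin.snoc (α := fun _ => Fin N × Fin K) h (i, j)) =
      playLaw Θ π ℓ t h * (π t (observations ℓ h) i * Θ i j) := by
  rw [playLaw, PMF.bind_apply, tsum_eq_single h, PMF.bind_apply, tsum_eq_single i,
    PMF.bind_apply, tsum_eq_single j]
  · simp
  · intro j' hj'
    rw [PMF.pure_apply, if_neg, mul_zero]
    intro he
    exact hj' (Prod.ext_iff.mp (Fin.snoc_injective2 he).2).2.symm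
  · intro i' hi'
    rw [PMF.bind_apply, ENNReal.tsum_eq_zero.mpr, mul_zero]
    intro j'
    rw [PMF.pure_apply, if_neg, mul_zero]
    intro he
    exact hi' (Prod.ext_iff.mp (Fin.snoc_injective2 he).2).1.symm
  · intro h' hh'
    rw [PMF.bind_apply, ENNReal.tsum_eq_zero.mpr, mul_zero]
    intro i'
    rw [PMF.bind_apply, ENNReal.tsum_eq_zero.mpr, mul_zero]
    intro j'
    rw [PMF.pure_apply, if_neg, mul_zero]
    intro he
    exact hh' (Fin.snoc_injective2 he).1.symm

/-- The probability of a play depends only on the losses that are observed along it. -/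
theorem playLaw_congr {ℓ ℓ' : ℕ → Fin K → ℝ} {t : ℕ} (h : Play N K t)
    (hℓ : ∀ s : Fin t, ℓ s (h s).2 = ℓ' s (h s).2) :
    playLaw Θ π ℓ t h = playLaw Θ π ℓ' t h := by
  induction t with
  | zero => rfl
  | succ t ih =>
    induction h using Fin.snocCases with
    | snoc h x =>
      obtain ⟨i, j⟩ := x
      have hs : ∀ s : Fin t, ℓ s (h s).2 = ℓ' s (h s).2 := fun s => by
        simpa using hℓ s.castSucc
      have ho : observations ℓ h = observations ℓ' h := by
        funext s
        simp [observations, hs s]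
      rw [playLaw_succ_snoc, playLaw_succ_snoc, ih h hs, ho]

theorem sum_toReal_eq_one {α : Type*} [Fintype α] (p : PMF α) : ∑ x, (p x).toReal = 1 := by
  have h := p.tsum_coe
  rw [tsum_fintype] at h
  rw [← ENNReal.toReal_sum fun x _ => p.apply_ne_top x, h, ENNReal.toReal_one]

/-- The probability that the policy `i` is selected in round `t`. -/
noncomputable def selectProb (ℓ : ℕ → Fin K → ℝ) (t : ℕ) (i : Fin N) : ℝ :=
  ∑ h : Play N K t, (playLaw Θ π ℓ t h).toReal * (π t (observations ℓ h) i).toReal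

theorem sum_selectProb (ℓ : ℕ → Fin K → ℝ) (t : ℕ) : ∑ i, selectProb Θ π ℓ t i = 1 := by
  simp only [selectProb]
  rw [Finset.sum_comm]
  simp only [← Finset.mul_sum, sum_toReal_eq_one, mul_one]

theorem selectProb_congr {ℓ ℓ' : ℕ → Fin K → ℝ} {t : ℕ} (hℓ : ∀ s < t, ℓ s = ℓ' s) (i : Fin N) :
    selectProb Θ π ℓ t i = selectProb Θ π ℓ' t i := by
  refine Finset.sum_congr rfl fun h _ => ?_
  have ho : observations ℓ h = observations ℓ' h := by
    funext s
    simp [observations, hℓ s s.isLt]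
  rw [playLaw_congr Θ π (ℓ' := ℓ') h fun s => by rw [hℓ s s.isLt], ho]

theorem sum_play_succ (t : ℕ) (F : Play N K (t + 1) → ℝ) :
    ∑ h, F h = ∑ h : Play N K t, ∑ i, ∑ j,
      F (Fin.snoc (α := fun _ => Fin N × Fin K) h (i, j)) := by
  rw [← (Fin.snocEquiv fun _ => Fin N × Fin K).sum_comp, Fintype.sum_prod_type_right]
  refine Finset.sum_congr rfl fun h _ => ?_
  rw [Fintype.sum_prod_type]
  rfl

/-- Conditioning on the past of the last round: the action probabilities sum to one, so only the law
of the selected policy remains. -/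
theorem sum_playLaw_mul_sum (ℓ : ℕ → Fin K → ℝ) (f : ℕ → Fin N → ℝ) (T : ℕ) :
    ∑ h : Play N K T, (playLaw Θ π ℓ T h).toReal * ∑ t : Fin T, f t (h t).1 =
      ∑ t : Fin T, ∑ i, selectProb Θ π ℓ t i * f t i := by
  induction T with
  | zero => simp
  | succ T ih =>
    rw [Fin.sum_univ_castSucc, sum_play_succ]
    simp only [playLaw_succ_snoc, Fin.sum_univ_castSucc, Fin.snoc_castSucc, Fin.snoc_last,
      Fin.val_castSucc, Fin.val_last, ENNReal.toReal_mul]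
    rw [← ih]
    have hsum : ∀ h : Play N K T, ∑ i, ∑ j, (playLaw Θ π ℓ T h).toReal *
        ((π T (observations ℓ h) i).toReal * (Θ i j).toReal) *
          (∑ t : Fin T, f t (h t).1 + f T i) =
        (playLaw Θ π ℓ T h).toReal * ∑ t : Fin T, f t (h t).1 +
          ∑ i, (playLaw Θ π ℓ T h).toReal * (π T (observations ℓ h) i).toReal * f T i := by
      intro h
      have hj : ∀ i, ∑ j, (playLaw Θ π ℓ T h).toReal *
          ((π T (observations ℓ h) i).toReal * (Θ i j).toReal) *
            (∑ t : Fin T, f t (h t).1 + f T i) =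
          (π T (observations ℓ h) i).toReal *
            ((playLaw Θ π ℓ T h).toReal * ∑ t : Fin T, f t (h t).1) +
          (playLaw Θ π ℓ T h).toReal * (π T (observations ℓ h) i).toReal * f T i := by
        intro i
        rw [← Finset.sum_mul, ← Finset.mul_sum, ← Finset.mul_sum, sum_toReal_eq_one]
        ring
      simp only [hj, Finset.sum_add_distrib, ← Finset.sum_mul, sum_toReal_eq_one, one_mul]
    simp only [hsum, Finset.sum_add_distrib, selectProb, Finset.sum_mul]
    congr 1
    exact Finset.sum_comm

end Law

/-! ### Random tables of bits -/

section Bits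

variable {K T : ℕ}

/-- The loss vectors given by a table of bits, extended by `0` after the last round. -/
def bitLoss (b : Fin T → Fin K → Bool) (t : ℕ) (j : Fin K) : ℝ :=
  if h : t < T then (if b ⟨t, h⟩ j then 1 else 0) else 0

theorem bitLoss_mem_Icc (b : Fin T → Fin K → Bool) (t : ℕ) (j : Fin K) :
    bitLoss b t j ∈ Set.Icc (0 : ℝ) 1 := by
  unfold bitLoss
  split_ifs <;> simp

theorem bitLoss_coe (b : Fin T → Fin K → Bool) (t : Fin T) (j : Fin K) :
    bitLoss b t j = if b t j then 1 else 0 := by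
  simp [bitLoss]

/-- The product weight on tables of bits whose rows are independent and identically distributed,
with independent entries of weights `p j`. -/
def tableWeight (p : Fin K → Bool → ℝ) (b : Fin T → Fin K → Bool) : ℝ :=
  ∏ t, ∏ j, p j (b t j)

theorem sum_row_weight {p : Fin K → Bool → ℝ} (hp : ∀ j, ∑ x, p j x = 1) :
    ∑ v : Fin K → Bool, ∏ j, p j (v j) = 1 := by
  rw [← Fintype.prod_sum]
  simp only [hp, Finset.prod_const_one]

theorem sum_row_weight_mul {p : Fin K → Bool → ℝ} (hp : ∀ j, ∑ x, p j x = 1) (k : Fin K)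
    (g : Bool → ℝ) :
    ∑ v : Fin K → Bool, (∏ j, p j (v j)) * g (v k) = ∑ x, p k x * g x := by
  have h := Fintype.prod_sum (fun j x => p j x * if j = k then g x else 1)
  have h1 : ∀ j, ∑ x, p j x * (if j = k then g x else 1) =
      if j = k then ∑ x, p k x * g x else 1 := by
    intro j
    split_ifs with hj
    · rw [hj]
    · simpa using hp j
  simp only [h1, Finset.prod_mul_distrib, Finset.prod_ite_eq', Finset.mem_univ, if_true] at h
  exact h.symm

theorem sum_tableWeight {p : Fin K → Bool → ℝ} (hp : ∀ j, ∑ x, p j x = 1) :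
    ∑ b : Fin T → Fin K → Bool, tableWeight p b = 1 := by
  have h := Fintype.prod_sum (fun (_ : Fin T) (v : Fin K → Bool) => ∏ j, p j (v j))
  simp only [sum_row_weight hp, Finset.prod_const_one] at h
  exact h.symm

/-- The entries read along a sequence of columns have the product law. -/
theorem sum_tableWeight_read {p : Fin K → Bool → ℝ} (hp : ∀ j, ∑ x, p j x = 1)
    (k : Fin T → Fin K) (G : (Fin T → Bool) → ℝ) :
    ∑ b : Fin T → Fin K → Bool, tableWeight p b * G (fun t => b t (k t)) =
      ∑ y : Fin T → Bool, (∏ t, p (k t) (y t)) * G y := by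
  have hy : ∀ y : Fin T → Bool, ∏ t, p (k t) (y t) =
      ∑ b : Fin T → Fin K → Bool, tableWeight p b * if (fun t => b t (k t)) = y then 1 else 0 := by
    intro y
    have h := Fintype.prod_sum (fun (t : Fin T) (v : Fin K → Bool) =>
      (∏ j, p j (v j)) * if v (k t) = y t then 1 else 0)
    have h1 : ∀ t, ∑ v : Fin K → Bool, (∏ j, p j (v j)) * (if v (k t) = y t then 1 else 0) =
        p (k t) (y t) := fun t => by
      rw [sum_row_weight_mul hp (k t) fun x => if x = y t then 1 else 0]
      simp only [mul_ite, mul_one, mul_zero, Finset.sum_ite_eq', Finset.mem_univ, if_true]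
    simp only [h1] at h
    rw [h]
    refine Finset.sum_congr rfl fun b _ => ?_
    by_cases hb : (fun t => b t (k t)) = y
    · rw [if_pos hb, mul_one]
      exact Finset.prod_congr rfl fun t _ => by rw [if_pos (congrFun hb t), mul_one]
    · rw [if_neg hb, mul_zero]
      obtain ⟨t, ht⟩ := Function.ne_iff.mp hb
      exact Finset.prod_eq_zero (Finset.mem_univ t) (by rw [if_neg ht, mul_zero])
  simp only [hy, Finset.sum_mul]
  rw [Finset.sum_comm]
  refine Finset.sum_congr rfl fun b _ => ?_
  simp

/-- A row is independent of any function of the other rows. -/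
theorem sum_tableWeight_mul_row {p : Fin K → Bool → ℝ} (hp : ∀ j, ∑ x, p j x = 1) (t : Fin T)
    (F : (Fin T → Fin K → Bool) → ℝ) (hF : ∀ b v, F (Function.update b t v) = F b)
    (k : Fin K) (g : Bool → ℝ) :
    ∑ b, tableWeight p b * (F b * g (b t k)) =
      (∑ b, tableWeight p b * F b) * ∑ x, p k x * g x := by
  -- Add a fresh independent row; exchanging it with row `t` preserves the joint weight and leaves
  -- `F` unchanged.
  let e : (Fin T → Fin K → Bool) × (Fin K → Bool) ≃ (Fin T → Fin K → Bool) × (Fin K → Bool) :=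
    { toFun := fun x => (Function.update x.1 t x.2, x.1 t)
      invFun := fun x => (Function.update x.1 t x.2, x.1 t)
      left_inv := fun x => by simp
      right_inv := fun x => by simp }
  have hw : ∀ b v, tableWeight p (Function.update b t v) * ∏ j, p j (b t j) =
      tableWeight p b * ∏ j, p j (v j) := by
    intro b v
    unfold tableWeight
    rw [← Finset.mul_prod_erase _ _ (Finset.mem_univ t),
      ← Finset.mul_prod_erase Finset.univ (fun s => ∏ j, p j (b s j)) (Finset.mem_univ t)]
    have : ∏ s ∈ Finset.univ.erase t, ∏ j, p j (Function.update b t v s j) =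
        ∏ s ∈ Finset.univ.erase t, ∏ j, p j (b s j) :=
      Finset.prod_congr rfl fun s hs => by rw [Function.update_of_ne (Finset.ne_of_mem_erase hs)]
    rw [this, Function.update_self]
    ring
  calc ∑ b, tableWeight p b * (F b * g (b t k))
      = ∑ b, ∑ v : Fin K → Bool,
          tableWeight p b * (∏ j, p j (v j)) * (F b * g (b t k)) := by
        refine Finset.sum_congr rfl fun b _ => ?_
        rw [← Finset.sum_mul, ← Finset.mul_sum, sum_row_weight hp, mul_one]
    _ = ∑ b, ∑ v : Fin K → Bool, tableWeight p b * F b * ((∏ j, p j (v j)) * g (v k)) := by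
        rw [← Fintype.sum_prod_type', ← Fintype.sum_prod_type', ← e.sum_comp]
        refine Finset.sum_congr rfl fun x _ => ?_
        simp only [e, Equiv.coe_fn_mk, hw, hF, Function.update_self]
        ring
    _ = _ := by
        simp only [← Finset.mul_sum, sum_row_weight_mul hp, Finset.sum_mul]

end Bits

/-! ### Change of measure -/

section ChangeOfMeasure

/-- The exponential lies above its tangent at `m = 59/100`, close to the optimal point; `exp
(-23/50)` is just below `1 - exp (-1)`, so `0 ≤ m` suffices. -/
theorem one_sub_mul_le_exp {m : ℝ} (hm : 0 ≤ m) : 1 - (1 - Real.exp (-1)) * m ≤ Real.exp (13 / 100 - m) := by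
  have h1 : Real.exp (-1) < 0.3679 := by
    rw [Real.exp_neg, inv_lt_comm₀ (Real.exp_pos _) (by norm_num)]
    exact lt_trans (by norm_num) Real.exp_one_gt_d9
  have h2 := Real.exp_bound (x := -0.46) (by norm_num [abs_le]) (n := 6) (by norm_num)
  norm_num [Finset.sum_range_succ, Nat.factorial, abs_le] at h2
  have h3 : Real.exp (13 / 100 - m) = Real.exp (-(23 / 50)) * Real.exp (59 / 100 - m) := by
    rw [← Real.exp_add]
    ring_nf
  have h4 := mul_le_mul_of_nonneg_left (Real.add_one_le_exp (59 / 100 - m))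
    (Real.exp_pos (-(23 / 50))).le
  rw [h3]
  nlinarith

/-- A Pinsker-type inequality: if `q i = p i * exp (-g i)`, the `q`-mean of a `[0, 1]`-valued
function exceeds its `p`-mean by at most the relative entropy `∑ i, p i * g i` plus a constant. -/
theorem sum_mul_le_of_density {ι : Type*} [Fintype ι] {p q f g : ι → ℝ} (hp : ∀ i, 0 ≤ p i)
    (hp1 : ∑ i, p i = 1) (hq1 : ∑ i, q i = 1) (hq : ∀ i, q i = p i * Real.exp (-g i))
    (hf0 : ∀ i, 0 ≤ f i) (hf1 : ∀ i, f i ≤ 1) :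
    ∑ i, q i * f i ≤ ∑ i, p i * f i + ∑ i, p i * g i + 13 / 100 := by
  have hq0 : ∀ i, 0 ≤ q i := fun i => by rw [hq]; exact mul_nonneg (hp i) (Real.exp_pos _).le
  have hchord : ∀ x : ℝ, 0 ≤ x → x ≤ 1 → Real.exp (-x) ≤ 1 - (1 - Real.exp (-1)) * x := by
    intro x h0 h1
    have := convexOn_exp.2 (Set.mem_univ (0 : ℝ)) (Set.mem_univ (-1 : ℝ)) (sub_nonneg.2 h1) h0
      (by ring)
    simp only [smul_eq_mul, mul_zero, zero_add, Real.exp_zero, mul_one, mul_neg] at this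
    linarith
  -- Jensen under `p`, as in the Donsker–Varadhan formula: the factor `exp (-g i)` turns the right
  -- side into the `q`-mean of `exp (-f)`, which the chord on `[0, 1]` bounds.
  have hj := convexOn_exp.map_sum_le (t := Finset.univ) (w := p) (p := fun i => -g i - f i)
    (fun i _ => hp i) hp1 (fun i _ => Set.mem_univ _)
  simp only [smul_eq_mul] at hj
  have hle : ∑ i, p i * Real.exp (-g i - f i) ≤ 1 - (1 - Real.exp (-1)) * ∑ i, q i * f i := by
    calc ∑ i, p i * Real.exp (-g i - f i)
        ≤ ∑ i, (q i - (1 - Real.exp (-1)) * (q i * f i)) := by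
          refine Finset.sum_le_sum fun i _ => ?_
          rw [sub_eq_add_neg, Real.exp_add, ← mul_assoc, ← hq]
          nlinarith [mul_le_mul_of_nonneg_left (hchord (f i) (hf0 i) (hf1 i)) (hq0 i)]
      _ = _ := by rw [Finset.sum_sub_distrib, hq1, Finset.mul_sum]
  have := Real.exp_le_exp.1 (hj.trans (hle.trans (one_sub_mul_le_exp
    (Finset.sum_nonneg fun i _ => mul_nonneg (hq0 i) (hf0 i)))))
  have hs : ∑ i, p i * (-g i - f i) = -∑ i, p i * g i - ∑ i, p i * f i := by
    simp only [mul_sub, mul_neg, Finset.sum_sub_distrib, Finset.sum_neg_distrib]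
  linarith

end ChangeOfMeasure

/-! ### Averages over random tables -/

section Averages

variable {N K : ℕ} (Θ : Fin N → PMF (Fin K)) (π : Strategy N K) {T : ℕ}

/-- The joint weight of a play and of the bits observed along it, when the table of bits is drawn
with entries of weights `p`. -/
noncomputable def jointWeight (p : Fin K → Bool → ℝ) (x : Play N K T × (Fin T → Bool)) : ℝ :=
  (playLaw Θ π (bitLoss fun t _ => x.2 t) T x.1).toReal * ∏ t, p (x.1 t).2 (x.2 t)

theorem sum_jointWeight_mul {p : Fin K → Bool → ℝ} (hp : ∀ j, ∑ x, p j x = 1)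
    (F : Play N K T → ℝ) :
    ∑ x, jointWeight Θ π p x * F x.1 =
      ∑ b : Fin T → Fin K → Bool, tableWeight p b * ∑ h, (playLaw Θ π (bitLoss b) T h).toReal * F h := by
  rw [Fintype.sum_prod_type]
  simp only [Finset.mul_sum]
  rw [Finset.sum_comm (s := Finset.univ (α := Fin T → Fin K → Bool))]
  refine Finset.sum_congr rfl fun h _ => ?_
  have hb := sum_tableWeight_read hp (fun t => (h t).2) fun y =>
    (playLaw Θ π (bitLoss fun t _ => y t) T h).toReal * F h
  -- Copying the observed bit across its whole row changes no loss seen along `h`.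
  have hL : ∀ b, playLaw Θ π (bitLoss fun t _ => b t (h t).2) T h =
      playLaw Θ π (bitLoss b) T h := fun b =>
    playLaw_congr Θ π h fun s => by simp only [bitLoss_coe]
  simp only [hL] at hb
  rw [hb]
  refine Finset.sum_congr rfl fun y _ => ?_
  simp only [jointWeight]
  ring

theorem sum_jointWeight {p : Fin K → Bool → ℝ} (hp : ∀ j, ∑ x, p j x = 1) :
    ∑ x : Play N K T × (Fin T → Bool), jointWeight Θ π p x = 1 := by
  have h := sum_jointWeight_mul Θ π hp (T := T) fun _ => 1
  simpa only [mul_one, sum_toReal_eq_one, sum_tableWeight hp] using h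

/-- The expected number of rounds in which the policy `i` is selected, when the table of bits is
drawn with entries of weights `p`. -/
noncomputable def meanCount (T : ℕ) (p : Fin K → Bool → ℝ) (i : Fin N) : ℝ :=
  ∑ t : Fin T, ∑ b : Fin T → Fin K → Bool, tableWeight p b * selectProb Θ π (bitLoss b) t i

theorem sum_tableWeight_mul_selectProb {p : Fin K → Bool → ℝ} (hp : ∀ j, ∑ x, p j x = 1)
    (t : Fin T) :
    ∑ i, ∑ b : Fin T → Fin K → Bool, tableWeight p b * selectProb Θ π (bitLoss b) t i = 1 := by
  rw [Finset.sum_comm]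
  simp only [← Finset.mul_sum, sum_selectProb, mul_one, sum_tableWeight hp]

theorem sum_meanCount {p : Fin K → Bool → ℝ} (hp : ∀ j, ∑ x, p j x = 1) :
    ∑ i, meanCount Θ π T p i = T := by
  simp only [meanCount]
  rw [Finset.sum_comm]
  simp [sum_tableWeight_mul_selectProb Θ π hp]

theorem meanCount_eq {p : Fin K → Bool → ℝ} (hp : ∀ j, ∑ x, p j x = 1) (i : Fin N) :
    meanCount Θ π T p i =
      ∑ x : Play N K T × (Fin T → Bool),
        jointWeight Θ π p x * ∑ t, if (x.1 t).1 = i then 1 else 0 := by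
  rw [sum_jointWeight_mul Θ π hp fun h => ∑ t, if (h t).1 = i then (1 : ℝ) else 0, meanCount,
    Finset.sum_comm]
  refine Finset.sum_congr rfl fun b _ => ?_
  rw [sum_playLaw_mul_sum Θ π (bitLoss b) (fun _ i' => if i' = i then (1 : ℝ) else 0),
    ← Finset.mul_sum]
  simp

/-- The policy of round `t` depends only on earlier rows, so it is independent of row `t`, whose
bits can be replaced by their means. -/
theorem sum_tableWeight_mul_expectedLoss {p : Fin K → Bool → ℝ} (hp : ∀ j, ∑ x, p j x = 1) :
    ∑ b : Fin T → Fin K → Bool, tableWeight p b * expectedLoss Θ π (bitLoss b) T =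
      ∑ i, meanCount Θ π T p i * policyLoss (Θ i) fun j => p j true := by
  have hb : ∀ b : Fin T → Fin K → Bool, tableWeight p b * expectedLoss Θ π (bitLoss b) T =
      ∑ i, ∑ t : Fin T, ∑ j, (Θ i j).toReal *
        (tableWeight p b * (selectProb Θ π (bitLoss b) t i * if b t j then 1 else 0)) := by
    intro b
    rw [expectedLoss,
      sum_playLaw_mul_sum Θ π (bitLoss b) (fun t i => policyLoss (Θ i) (bitLoss b t)),
      Finset.sum_comm, Finset.mul_sum]
    refine Finset.sum_congr rfl fun i _ => ?_
    rw [Finset.mul_sum]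
    refine Finset.sum_congr rfl fun t _ => ?_
    simp only [policyLoss, Finset.mul_sum, bitLoss_coe]
    refine Finset.sum_congr rfl fun j _ => ?_
    ring
  simp only [hb]
  rw [Finset.sum_comm]
  refine Finset.sum_congr rfl fun i _ => ?_
  rw [Finset.sum_comm, meanCount, Finset.sum_mul]
  refine Finset.sum_congr rfl fun t _ => ?_
  rw [Finset.sum_comm, policyLoss, Finset.mul_sum]
  refine Finset.sum_congr rfl fun j _ => ?_
  rw [← Finset.mul_sum]
  have := sum_tableWeight_mul_row hp t (fun b => selectProb Θ π (bitLoss b) t i)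
    (fun b v => selectProb_congr Θ π (fun s hs => ?_) i) j fun x => if x then 1 else 0
  · rw [this]
    simp
    ring
  · have hsT : s < T := hs.trans t.isLt
    have hne : (⟨s, hsT⟩ : Fin T) ≠ t := fun h => hs.ne (congrArg Fin.val h)
    funext j
    simp [bitLoss, hsT, Function.update_of_ne hne]

theorem sum_tableWeight_mul_policyLoss {p : Fin K → Bool → ℝ} (hp : ∀ j, ∑ x, p j x = 1)
    (θ : PMF (Fin K)) :
    ∑ b : Fin T → Fin K → Bool, tableWeight p b * ∑ t : Fin T, policyLoss θ (bitLoss b t) =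
      T * policyLoss θ fun j => p j true := by
  have ht : ∀ t : Fin T, ∑ b : Fin T → Fin K → Bool, tableWeight p b * policyLoss θ (bitLoss b t) =
      policyLoss θ fun j => p j true := by
    intro t
    simp only [policyLoss, Finset.mul_sum, bitLoss_coe]
    rw [Finset.sum_comm]
    refine Finset.sum_congr rfl fun j _ => ?_
    have := sum_tableWeight_mul_row hp t (fun _ => 1) (fun _ _ => rfl) j
      fun x => if x then 1 else 0
    simp only [one_mul, mul_one, sum_tableWeight hp, Fintype.sum_bool, if_true,
      Bool.false_eq_true, if_false, mul_zero, add_zero] at this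
    rw [← this, Finset.mul_sum]
    refine Finset.sum_congr rfl fun b _ => ?_
    ring
  simp only [Finset.mul_sum]
  rw [Finset.sum_comm]
  simp [ht]

theorem tableWeight_nonneg {p : Fin K → Bool → ℝ} (hp : ∀ j x, 0 ≤ p j x)
    (b : Fin T → Fin K → Bool) : 0 ≤ tableWeight p b :=
  Finset.prod_nonneg fun _ _ => Finset.prod_nonneg fun _ _ => hp _ _

theorem meanLoss_sub_le_sum_regret {p : Fin K → Bool → ℝ} (hp : ∀ j, ∑ x, p j x = 1)
    (hp0 : ∀ j x, 0 ≤ p j x) (i : Fin N) :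
    ∑ i', meanCount Θ π T p i' * policyLoss (Θ i') (fun j => p j true) -
        T * policyLoss (Θ i) (fun j => p j true) ≤
      ∑ b : Fin T → Fin K → Bool, tableWeight p b * regret Θ π (bitLoss b) T := by
  rw [← sum_tableWeight_mul_expectedLoss Θ π hp, ← sum_tableWeight_mul_policyLoss hp,
    ← Finset.sum_sub_distrib]
  refine Finset.sum_le_sum fun b _ => ?_
  rw [← mul_sub]
  refine mul_le_mul_of_nonneg_left (sub_le_sub_left ?_ _) (tableWeight_nonneg hp0 b)
  exact ciInf_le (Set.finite_range _).bddBelow i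

end Averages

/-! ### One biased arm -/

section Hypotheses

variable {N K : ℕ}

/-- The likelihood ratio of a bit of mean `1 / 2 - δ` to a fair bit. -/
def bitRatio (δ : ℝ) (x : Bool) : ℝ := if x then 1 - 2 * δ else 1 + 2 * δ

/-- Fair bits, except that the bits of the arm `k` have mean `1 / 2 - δ`. -/
noncomputable def biasedWeight (δ : ℝ) (k j : Fin K) (x : Bool) : ℝ :=
  1 / 2 * if j = k then bitRatio δ x else 1

theorem sum_biasedWeight (δ : ℝ) (k j : Fin K) : ∑ x, biasedWeight δ k j x = 1 := by
  simp only [biasedWeight, bitRatio, Fintype.sum_bool]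
  split_ifs <;> first | contradiction | ring

theorem bitRatio_pos {δ : ℝ} (h0 : 0 ≤ δ) (h1 : δ ≤ 1 / 4) (x : Bool) : 0 < bitRatio δ x := by
  unfold bitRatio
  split_ifs <;> linarith

theorem biasedWeight_nonneg {δ : ℝ} (h0 : 0 ≤ δ) (h1 : δ ≤ 1 / 4) (k j : Fin K) (x : Bool) :
    0 ≤ biasedWeight δ k j x := by
  unfold biasedWeight
  have := bitRatio_pos h0 h1 x
  split_ifs <;> linarith

theorem policyLoss_biasedWeight (θ : PMF (Fin K)) (δ : ℝ) (k : Fin K) :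
    policyLoss θ (fun j => biasedWeight δ k j true) = 1 / 2 - δ * (θ k).toReal := by
  have hj : ∀ j, (θ j).toReal * biasedWeight δ k j true =
      1 / 2 * (θ j).toReal - if j = k then δ * (θ j).toReal else 0 := by
    intro j
    simp only [biasedWeight, bitRatio, if_true]
    split_ifs <;> ring
  simp only [policyLoss, hj, Finset.sum_sub_distrib, ← Finset.mul_sum, sum_toReal_eq_one,
    Finset.sum_ite_eq', Finset.mem_univ, if_true, mul_one]

/-- By concavity of the logarithm, its graph lies above the chord joining `1` and `3/4`. -/
theorem neg_log_one_sub_le {x : ℝ} (h0 : 0 ≤ x) (h1 : x ≤ 1 / 4) :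
    -Real.log (1 - x) ≤ 4 * Real.log (4 / 3) * x := by
  have h := strictConcaveOn_log_Ioi.concaveOn.2 (Set.mem_Ioi.2 one_pos)
    (Set.mem_Ioi.2 (by norm_num : (0 : ℝ) < 3 / 4)) (by linarith : 0 ≤ 1 - 4 * x)
    (by linarith : 0 ≤ 4 * x) (by ring)
  have h34 : Real.log (3 / 4) = -Real.log (4 / 3) := by rw [← Real.log_inv]; norm_num
  simp only [smul_eq_mul, Real.log_one, h34] at h
  have he : (1 - 4 * x) * 1 + 4 * x * (3 / 4) = 1 - x := by ring
  rw [he] at h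
  linarith

/-- The total relative entropy of the biased laws with respect to the fair one does not depend on
the strategy. -/
theorem sum_meanCount_biasedWeight_le (Θ : Fin N → PMF (Fin K)) (π : Strategy N K) {T : ℕ}
    (hT : 0 < T) {a : Fin N → Fin K} (ha : Function.Bijective a) {δ : ℝ} (h0 : 0 ≤ δ)
    (h1 : δ ≤ 1 / 4) :
    ∑ i, meanCount Θ π T (biasedWeight δ (a i)) i ≤
      T * (1 + 8 * Real.log (4 / 3) * T * δ ^ 2 + 13 / 100 * N) := by
  have hT' : (0 : ℝ) < T := Nat.cast_pos.2 hT
  let u : Fin K → Bool → ℝ := fun _ _ => 1 / 2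
  have hu : ∀ j, ∑ x, u j x = 1 := fun j => by norm_num [u]
  let g : Fin N → Play N K T × (Fin T → Bool) → ℝ := fun i x =>
    ∑ t, if (x.1 t).2 = a i then -Real.log (bitRatio δ (x.2 t)) else 0
  have hq : ∀ i x, jointWeight Θ π (biasedWeight δ (a i)) x =
      jointWeight Θ π u x * Real.exp (-g i x) := by
    intro i x
    simp only [jointWeight, u, g, biasedWeight]
    rw [← Finset.sum_neg_distrib, Real.exp_sum, mul_assoc, ← Finset.prod_mul_distrib]
    congr 1
    refine Finset.prod_congr rfl fun t _ => ?_
    split_ifs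
    · rw [neg_neg, Real.exp_log (bitRatio_pos h0 h1 _)]
    · simp
  have hi : ∀ i, meanCount Θ π T (biasedWeight δ (a i)) i ≤
      meanCount Θ π T u i + T * ∑ x, jointWeight Θ π u x * g i x + T * (13 / 100) := by
    intro i
    have hn : ∀ x : Play N K T × (Fin T → Bool),
        (∑ t, if (x.1 t).1 = i then (1 : ℝ) else 0) ≤ T := fun x => by
      calc (∑ t, if (x.1 t).1 = i then (1 : ℝ) else 0) ≤ ∑ _t : Fin T, (1 : ℝ) :=
            Finset.sum_le_sum fun t _ => by split_ifs <;> norm_num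
        _ = T := by simp
    have h := sum_mul_le_of_density (p := jointWeight Θ π u)
      (q := jointWeight Θ π (biasedWeight δ (a i))) (g := g i)
      (f := fun x => (∑ t, if (x.1 t).1 = i then (1 : ℝ) else 0) / T)
      (fun x => mul_nonneg ENNReal.toReal_nonneg (Finset.prod_nonneg fun _ _ => by norm_num [u]))
      (sum_jointWeight Θ π hu) (sum_jointWeight Θ π (sum_biasedWeight δ (a i))) (hq i)
      (fun x => div_nonneg (Finset.sum_nonneg fun t _ => by split_ifs <;> norm_num) hT'.le)
      (fun x => (div_le_one hT').2 (hn x))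
    simp only [mul_div_assoc', ← Finset.sum_div] at h
    rw [← meanCount_eq Θ π (sum_biasedWeight δ (a i)), ← meanCount_eq Θ π hu, div_le_iff₀ hT'] at h
    refine h.trans (le_of_eq ?_)
    field_simp
  have hKL : ∑ i, ∑ x, jointWeight Θ π u x * g i x = T * (-Real.log (1 - 4 * δ ^ 2) / 2) := by
    -- Since `a` is bijective, each round contributes to exactly one `i`; the sum forgets which arms
    -- were played.
    have hg : ∀ x, ∑ i, g i x = ∑ t, -Real.log (bitRatio δ (x.2 t)) := by
      intro x
      simp only [g]
      rw [Finset.sum_comm]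
      refine Finset.sum_congr rfl fun t _ => ?_
      obtain ⟨i, hi⟩ := ha.2 (x.1 t).2
      rw [← hi]
      simp [ha.1.eq_iff]
    rw [Finset.sum_comm]
    simp only [← Finset.mul_sum, hg, jointWeight, u]
    rw [Fintype.sum_prod_type_right]
    have ht : ∀ t : Fin T, ∑ y : Fin T → Bool,
        (∏ _s : Fin T, (1 / 2 : ℝ)) * -Real.log (bitRatio δ (y t)) =
          -Real.log (1 - 4 * δ ^ 2) / 2 := by
      intro t
      rw [sum_row_weight_mul (p := fun (_ : Fin T) _ => (1 / 2 : ℝ)) (fun _ => by norm_num) t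
        fun x => -Real.log (bitRatio δ x), Fintype.sum_bool]
      have hm : 1 - 4 * δ ^ 2 = bitRatio δ true * bitRatio δ false := by
        simp only [bitRatio, if_true, Bool.false_eq_true, if_false]
        ring
      rw [hm, Real.log_mul (bitRatio_pos h0 h1 _).ne' (bitRatio_pos h0 h1 _).ne']
      ring
    simp only [mul_assoc, ← Finset.sum_mul, sum_toReal_eq_one, one_mul]
    simp only [Finset.mul_sum]
    rw [Finset.sum_comm]
    simp only [ht, Finset.sum_const, Finset.card_univ, Fintype.card_fin, nsmul_eq_mul]
  have hlog := neg_log_one_sub_le (x := 4 * δ ^ 2) (by positivity) (by nlinarith)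
  calc ∑ i, meanCount Θ π T (biasedWeight δ (a i)) i
      ≤ ∑ i, (meanCount Θ π T u i + T * ∑ x, jointWeight Θ π u x * g i x + T * (13 / 100)) :=
        Finset.sum_le_sum fun i _ => hi i
    _ = T + T * (T * (-Real.log (1 - 4 * δ ^ 2) / 2)) + N * (T * (13 / 100)) := by
        rw [Finset.sum_add_distrib, Finset.sum_add_distrib, sum_meanCount Θ π hu, ← Finset.mul_sum,
          hKL]
        simp
    _ ≤ T + T * (T * (4 * Real.log (4 / 3) * (4 * δ ^ 2) / 2)) + N * (T * (13 / 100)) := by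
        gcongr
    _ = _ := by ring

end Hypotheses

/-! ### From averages to one bad table -/

/-- Some table of bits has regret at least the average over the biased laws. -/
theorem exists_bitLoss_le_regret {N K : ℕ} (hK : 2 ≤ K) {ε : ℝ} {Θ : Fin N → PMF (Fin K)}
    (hΘ : IsEpsUniform ε Θ) {T : ℕ} (hT : 0 < T) (π : Strategy N K) {δ : ℝ} (h0 : 0 ≤ δ)
    (h1 : δ ≤ 1 / 4) :
    ∃ b : Fin T → Fin K → Bool,
      ε * δ * T * (1 / 2 - 8 * Real.log (4 / 3) * T * δ ^ 2 / K - 13 / 100) ≤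
        regret Θ π (bitLoss b) T := by
  obtain ⟨hε, -, rfl, a, ha, hΘa⟩ := hΘ
  have hN : (2 : ℝ) ≤ N := by exact_mod_cast hK
  by_contra! hlt
  set B := ε * δ * T * (1 / 2 - 8 * Real.log (4 / 3) * T * δ ^ 2 / N - 13 / 100) with hB
  have hreg : ∀ i, ε * δ * (T - meanCount Θ π T (biasedWeight δ (a i)) i) < B := by
    intro i
    have h := meanLoss_sub_le_sum_regret Θ π (T := T) (sum_biasedWeight δ (a i))
      (biasedWeight_nonneg h0 h1 (a i)) i
    -- The uniform part of every policy meets the biased arm equally; only policy `i` gains the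
    -- extra `ε * δ`.
    have hm : ∀ i', meanCount Θ π T (biasedWeight δ (a i)) i' *
        policyLoss (Θ i') (fun j => biasedWeight δ (a i) j true) =
        meanCount Θ π T (biasedWeight δ (a i)) i' * (1 / 2 - δ * ((1 - ε) / N)) -
          if i = i' then ε * δ * meanCount Θ π T (biasedWeight δ (a i)) i' else 0 := by
      intro i'
      rw [policyLoss_biasedWeight, hΘa]
      simp only [ha.1.eq_iff]
      split_ifs <;> ring
    rw [Finset.sum_congr rfl fun i' _ => hm i'] at h
    simp only [Finset.sum_sub_distrib, ← Finset.sum_mul, Finset.sum_ite_eq, Finset.mem_univ,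
      if_true, sum_meanCount Θ π (sum_biasedWeight δ (a i)), policyLoss_biasedWeight, hΘa] at h
    have hlt' : ∑ b : Fin T → Fin N → Bool, tableWeight (biasedWeight δ (a i)) b *
        regret Θ π (bitLoss b) T < B := by
      have hone := sum_tableWeight (T := T) (sum_biasedWeight δ (a i))
      rw [← one_mul B, ← hone, Finset.sum_mul]
      refine Finset.sum_lt_sum (fun b _ => mul_le_mul_of_nonneg_left (hlt b).le
        (tableWeight_nonneg (biasedWeight_nonneg h0 h1 (a i)) b)) ?_
      -- Strictness needs a table of positive weight: otherwise all weights vanish, yet they sum to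
      -- one.
      by_contra! hz
      have : ∀ b : Fin T → Fin N → Bool, tableWeight (biasedWeight δ (a i)) b = 0 := fun b => by
        have := hz b (Finset.mem_univ b)
        have hb := hlt b
        have := tableWeight_nonneg (biasedWeight_nonneg h0 h1 (a i)) b
        nlinarith
      simp [this] at hone
    linarith
  have hsum := Finset.sum_lt_sum_of_nonempty (s := Finset.univ (α := Fin N))
    ⟨⟨0, by omega⟩, Finset.mem_univ _⟩ fun i _ => hreg i
  rw [← Finset.mul_sum, Finset.sum_sub_distrib] at hsum
  simp only [Finset.sum_const, Finset.card_univ, Fintype.card_fin, nsmul_eq_mul] at hsum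
  have hc := sum_meanCount_biasedWeight_le Θ π hT ha h0 h1
  -- Here `2 ≤ N` enters, through `1 ≤ N / 2`.
  have hle : ε * δ * (N * T - T * (N / 2 + 8 * Real.log (4 / 3) * T * δ ^ 2 + 13 / 100 * N)) ≤
      ε * δ * (N * T - ∑ i, meanCount Θ π T (biasedWeight δ (a i)) i) := by
    refine mul_le_mul_of_nonneg_left (sub_le_sub_left (hc.trans ?_) _) (mul_nonneg hε h0)
    gcongr
    linarith
  have hNB : N * B =
      ε * δ * (N * T - T * (N / 2 + 8 * Real.log (4 / 3) * T * δ ^ 2 + 13 / 100 * N)) := by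
    rw [hB]
    field_simp
    ring
  linarith

end FixedAdvice

/-! ### Choice of the bias -/

theorem theorem5 {N K : ℕ} (hK : 2 ≤ K) (ε : ℝ) (Θ : Fin N → PMF (Fin K))
    (hΘ : FixedAdvice.IsEpsUniform ε Θ) (T : ℕ)
    (hT : (K : ℝ) / (4 * Real.log (4 / 3)) ≤ T) (π : FixedAdvice.Strategy N K) :
    ∃ ℓ : ℕ → Fin K → ℝ, (∀ t j, ℓ t j ∈ Set.Icc (0 : ℝ) 1) ∧
      1 / 18 * ε * Real.sqrt (K * T) ≤ FixedAdvice.regret Θ π ℓ T := by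
  set c := Real.log (4 / 3) with hc
  have hc0 : 0 < c := Real.log_pos (by norm_num)
  have hc1 : c ≤ 3 / 10 := by
    rw [hc, Real.log_le_iff_le_exp (by norm_num)]
    exact le_trans (by norm_num) (Real.quadratic_le_exp_of_nonneg (by norm_num : (0 : ℝ) ≤ 3 / 10))
  have hK0 : (0 : ℝ) < K := by exact_mod_cast (by omega : 0 < K)
  have hT0 : (0 : ℝ) < T := lt_of_lt_of_le (by positivity) hT
  set r := Real.sqrt c with hr
  set s := Real.sqrt (K * T) with hs
  have hr0 : 0 < r := Real.sqrt_pos.2 hc0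
  have hrc : r ^ 2 = c := Real.sq_sqrt hc0.le
  have hr1 : r ≤ 11 / 20 := Real.sqrt_le_iff.2 ⟨by norm_num, by linarith⟩
  have hs0 : 0 < s := Real.sqrt_pos.2 (by positivity)
  have hsK : s ^ 2 = K * T := Real.sq_sqrt (by positivity)
  have hs1 : s ≤ 2 * r * T := by
    refine Real.sqrt_le_iff.2 ⟨by positivity, ?_⟩
    rw [div_le_iff₀ (by positivity)] at hT
    calc (K : ℝ) * T ≤ T * (4 * c) * T := by gcongr
      _ = (2 * r * T) ^ 2 := by rw [mul_pow, mul_pow, hrc]; ring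
  -- This value of `δ` makes the entropy term equal to `1/8`; the lower bound on `T` is what keeps
  -- it at most `1/4`.
  have hδ : s / (8 * r * T) ≤ 1 / 4 := by
    rw [div_le_iff₀ (by positivity)]
    linarith
  obtain ⟨b, hb⟩ := FixedAdvice.exists_bitLoss_le_regret hK hΘ (Nat.cast_pos.1 hT0) π
    (by positivity : 0 ≤ s / (8 * r * T)) hδ
  refine ⟨FixedAdvice.bitLoss b, FixedAdvice.bitLoss_mem_Icc b, le_trans ?_ hb⟩
  have hkl : 8 * c * T * (s / (8 * r * T)) ^ 2 / K = 1 / 8 := by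
    rw [div_pow, mul_pow, mul_pow, hsK, hrc]
    field_simp
  rw [← hc, hkl]
  have he : ε * (s / (8 * r * T)) * T = ε * s * (1 / (8 * r)) := by
    field_simp
  have hinv : 1 / (8 * (11 / 20)) ≤ 1 / (8 * r) := by gcongr
  have hεs : 0 ≤ ε * s := mul_nonneg hΘ.nonneg hs0.le
  rw [he]
  -- Numerically, `(1/2 - 1/8 - 13/100) / (8 * (11/20)) = 0.245 / 4.4`, just above `1/18`.
  nlinarith [mul_le_mul_of_nonneg_left hinv hεs]
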